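/- Let $\mathcal{E}$ be a cartesian closed category with finite limits (for instance a topos) and let $R$ be a commutative ring object of $\mathcal{E}$ which is a number line in the sense of synthetic differential geometry. That is, with $D=\{d\in R\mid d^2=0\}$, assume: (Kock–Lawvere axiom) the map $R\times R\to R^D$, $(u,v)\mapsto(d\mapsto u+d\cdot v)$, is invertible. Hence every $f\in R^R$ has a derivative $f'\in R^R$, determined by $f(x+d)=f(x)+d\cdot f'(x)$ for all $x\in R$, $d\in D$. (Integration axiom) for every $f\in R^R$ there is a unique $F\in R^R$ with $F'=f$ and $F(0)=0$. One puts $\int_a^b f(x)\,dx:=F(b)-F(a)$ for $a,b\in R$. Let $\mathcal{D}'_c(R)\subseteq R^{R^R}$ be the object of distributions of compact support on the line, i.e. of $R$-linear maps $R^R\to R$. For $a,b\in R$ let $[a,b]\in\mathcal{D}'_c(R)$ be the distribution $f\mapsto\int_a^b f(x)\,dx$; its length is $b-a$. The axioms and the assertions below are understood in the internal sense: they refer to generalized elements $X\to R$, $X\to R^R$, etc. at an arbitrary stage $X$ of $\mathcal{E}$. **Proposition.** For all $a_1,b_1,a_2,b_2\in R$, the intervals $[a_1,b_1]$ and $[a_2,b_2]$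 are equal as distributions if and only if they have the same length, $b_1-a_1=b_2-a_2$ $(=l$, say$)$, and $l\cdot(a_1-a_2)=0$; in this case also $l\cdot(b_1-b_2)=0$. In particular, if $[a_1,b_1]=[a_2,b_2]$ and the length $b_1-a_1$ is invertible, then $a_1=a_2$ and $b_1=b_2$; and for all $t_1,t_2\in R$, $[-t_1,t_1]=[-t_2,t_2]$ implies $t_1=t_2$. -/

import Mathlib

open CategoryTheory Limits MonoidalCategory CartesianMonoidalCategory MonoidalClosed
open scoped CommRingObj

universe v u

set_option linter.unusedSectionVars false

noncomputable section

namespace SDG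

/-! Throughout, `C` is a cartesian closed category with finite limits (for instance a topos) and
`R` is a commutative ring object of `C`, the number line. Morphisms `X ⟶ R` are the elements of `R`
at stage `X`; they form a commutative ring. Statements of the internal language of `C` are
spelled out by quantifying over elements at all stages. -/

variable {C : Type u} [Category.{v} C] [CartesianMonoidalCategory C] [BraidedCategory C]
  [MonoidalClosed C] [HasFiniteLimits C] (R : C) [CommRingObj R]

/-- The object `D = {d ∈ R | d ^ 2 = 0}`. -/
def D : C := equalizer ((𝟙 R : R ⟶ R) * 𝟙 R) (0 : R ⟶ R)

/-- The inclusion of `D` in `R`. -/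
def D.ι : D R ⟶ R := equalizer.ι ((𝟙 R : R ⟶ R) * 𝟙 R) (0 : R ⟶ R)

/-- The canonical map `α : R × R ⟶ R ^ D`, `α (u, v) (d) = u + d * v`. -/
def alpha : R ⊗ R ⟶ (ihom (D R)).obj R :=
  curry ((snd (D R) (R ⊗ R) ≫ fst R R) +
    (fst (D R) (R ⊗ R) ≫ D.ι R) * (snd (D R) (R ⊗ R) ≫ snd R R))

/-- The Kock-Lawvere axiom: every map `D ⟶ R` is of the form `d ↦ u + d * v` for a unique
pair `(u, v)`, i.e. the canonical map `R × R ⟶ R ^ D` is invertible. -/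
class KockLawvere : Prop where
  isIso_alpha : IsIso (alpha R)

attribute [instance] KockLawvere.isIso_alpha

/-- The object `R ^ R` of all functions on the line. -/
abbrev Fn : C := (ihom R).obj R

variable {R}

/-- The value `f (x)` of a function `f` at `x`, both given at stage `X`. -/
def app {X : C} (x : X ⟶ R) (f : X ⟶ Fn R) : X ⟶ R := lift x f ≫ (ihom.ev R).app R

variable (R)

section Deriv

variable [KockLawvere R]

/-- Principal part formation `R ^ D ⟶ R`, `(d ↦ u + d * v) ↦ v`. -/
def principalPart : (ihom (D R)).obj R ⟶ R := inv (alpha R) ≫ snd R R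

/-- Differentiation `R ^ R ⟶ R ^ R`, `f ↦ f'`, where `f' (x)` is the principal part of the map
`d ↦ f (x + d)`. -/
def deriv : Fn R ⟶ Fn R :=
  curry
    (curry
      (app ((snd (D R) (R ⊗ Fn R) ≫ fst R (Fn R)) + (fst (D R) (R ⊗ Fn R) ≫ D.ι R))
        (snd (D R) (R ⊗ Fn R) ≫ snd R (Fn R))) ≫
      principalPart R)

/-- The integration axiom: every function `f : R → R` has a unique primitive `F : R → R`
with `F (0) = 0`. -/
class IntegrationAxiom : Prop where
  existsUnique_primitive : ∀ ⦃X : C⦄ (f : X ⟶ Fn R),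
    ∃! F : X ⟶ Fn R, F ≫ deriv R = f ∧ app (0 : X ⟶ R) F = 0

end Deriv

/-! ### Linear functionals on functions -/

/-- The map `R × (R ^ R × R ^ R) ⟶ R ^ R`, `(r, (f, g)) ↦ r * f + g`, the module operations of
`R ^ R` being pointwise. -/
def linComb : R ⊗ (Fn R ⊗ Fn R) ⟶ Fn R :=
  curry
    ((snd R (R ⊗ (Fn R ⊗ Fn R)) ≫ fst R (Fn R ⊗ Fn R)) *
        app (fst R (R ⊗ (Fn R ⊗ Fn R)))
          (snd R (R ⊗ (Fn R ⊗ Fn R)) ≫ snd R (Fn R ⊗ Fn R) ≫ fst (Fn R) (Fn R)) +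
      app (fst R (R ⊗ (Fn R ⊗ Fn R)))
        (snd R (R ⊗ (Fn R ⊗ Fn R)) ≫ snd R (Fn R ⊗ Fn R) ≫ snd (Fn R) (Fn R)))

/-- The object `R ^ (R ^ R)` of all functionals on functions on the line. -/
abbrev Functional : C := (ihom (Fn R)).obj R

variable {R}

/-- The value `Φ (f)` of a functional `Φ` at a function `f`, both given at stage `X`. -/
def Functional.app {X : C} (Φ : X ⟶ Functional R) (f : X ⟶ Fn R) : X ⟶ R :=
  lift f Φ ≫ (ihom.ev (Fn R)).app R

variable (R)

/-- `Φ ↦ ((r, (f, g)) ↦ Φ (r * f + g))`. -/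
def atLinComb : Functional R ⟶ (ihom (R ⊗ (Fn R ⊗ Fn R))).obj R :=
  curry (Functional.app (snd (R ⊗ (Fn R ⊗ Fn R)) (Functional R))
    (fst (R ⊗ (Fn R ⊗ Fn R)) (Functional R) ≫ linComb R))

/-- `Φ ↦ ((r, (f, g)) ↦ r * Φ (f) + Φ (g))`. -/
def linCombAt : Functional R ⟶ (ihom (R ⊗ (Fn R ⊗ Fn R))).obj R :=
  curry
    ((fst (R ⊗ (Fn R ⊗ Fn R)) (Functional R) ≫ fst R (Fn R ⊗ Fn R)) *
        Functional.app (snd (R ⊗ (Fn R ⊗ Fn R)) (Functional R))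
          (fst (R ⊗ (Fn R ⊗ Fn R)) (Functional R) ≫ snd R (Fn R ⊗ Fn R) ≫ fst (Fn R) (Fn R)) +
      Functional.app (snd (R ⊗ (Fn R ⊗ Fn R)) (Functional R))
        (fst (R ⊗ (Fn R ⊗ Fn R)) (Functional R) ≫ snd R (Fn R ⊗ Fn R) ≫ snd (Fn R) (Fn R)))

/-- The object `𝒟'_c (R)` of distributions of compact support on the line: the `R`-linear dual of
`R ^ R`, i.e. the subobject of `R ^ (R ^ R)` of all `Φ` such that
`Φ (r * f + g) = r * Φ (f) + Φ (g)` for all `r`, `f` and `g`. -/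
def Distribution : C := equalizer (atLinComb R) (linCombAt R)

/-- The inclusion of `𝒟'_c (R)` in `R ^ (R ^ R)`. -/
def Distribution.ι : Distribution R ⟶ Functional R := equalizer.ι (atLinComb R) (linCombAt R)

variable {R}

/-! ### Calculus with elements -/

section Lemmas

variable {X Y : C}

theorem comp_app (u : Y ⟶ X) (x : X ⟶ R) (f : X ⟶ Fn R) :
    u ≫ app x f = app (u ≫ x) (u ≫ f) := by
  rw [app, app, ← comp_lift, Category.assoc]

theorem comp_functional_app (u : Y ⟶ X) (Φ : X ⟶ Functional R) (f : X ⟶ Fn R) :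
    u ≫ Functional.app Φ f = Functional.app (u ≫ Φ) (u ≫ f) := by
  rw [Functional.app, Functional.app, ← comp_lift, Category.assoc]

theorem lift_comp_uncurry {A B : C} (a : X ⟶ A) (u : X ⟶ Y) (f : Y ⟶ (ihom A).obj B) :
    lift a u ≫ uncurry f = lift a (u ≫ f) ≫ (ihom.ev A).app B := by
  rw [uncurry_eq, lift_whiskerLeft_assoc]

theorem lift_curry_ev {A B : C} (a : X ⟶ A) (u : X ⟶ Y) (f : A ⊗ Y ⟶ B) :
    lift a (u ≫ curry f) ≫ (ihom.ev A).app B = lift a u ≫ f := by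
  rw [← lift_comp_uncurry, uncurry_curry]

theorem app_curry (x : X ⟶ R) (u : X ⟶ Y) (f : R ⊗ Y ⟶ R) :
    app x (u ≫ curry f) = lift x u ≫ f := lift_curry_ev x u f

theorem functional_app_curry (f : X ⟶ Fn R) (u : X ⟶ Y) (φ : Fn R ⊗ Y ⟶ R) :
    Functional.app (u ≫ curry φ) f = lift f u ≫ φ := lift_curry_ev f u φ

theorem ihom_ext {A B : C} {f g : X ⟶ (ihom A).obj B}
    (h : ∀ ⦃Y : C⦄ (u : Y ⟶ X) (a : Y ⟶ A),
      lift a (u ≫ f) ≫ (ihom.ev A).app B = lift a (u ≫ g) ≫ (ihom.ev A).app B) : f = g := by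
  apply uncurry_injective
  have := h (snd A X) (fst A X)
  rw [← lift_comp_uncurry, ← lift_comp_uncurry] at this
  simpa using this

/-- Functions are equal if they have equal values at all later stages. -/
theorem fn_ext {f g : X ⟶ Fn R}
    (h : ∀ ⦃Y : C⦄ (u : Y ⟶ X) (x : Y ⟶ R), app x (u ≫ f) = app x (u ≫ g)) : f = g :=
  ihom_ext h

theorem D.ι_mul_self : D.ι R * D.ι R = 0 := by
  have h : D.ι R ≫ ((𝟙 R : R ⟶ R) * 𝟙 R) = D.ι R ≫ (0 : R ⟶ R) := equalizer.condition _ _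
  simpa [MonObj.comp_mul, AddMonObj.comp_zero] using h

theorem D.exists_lift (d : X ⟶ R) (h : d * d = 0) : ∃ e : X ⟶ D R, e ≫ D.ι R = d :=
  ⟨equalizer.lift d (by simpa [MonObj.comp_mul, AddMonObj.comp_zero] using h),
    equalizer.lift_ι _ _⟩

theorem alpha_apply (d : X ⟶ D R) (w : X ⟶ R ⊗ R) :
    lift d (w ≫ alpha R) ≫ (ihom.ev (D R)).app R =
      w ≫ fst R R + (d ≫ D.ι R) * (w ≫ snd R R) := by
  rw [alpha, lift_curry_ev]
  simp [MonObj.comp_mul, AddMonObj.comp_add]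

section Calculus

variable [KockLawvere R]

theorem app_deriv (x : X ⟶ R) (f : X ⟶ Fn R) :
    app x (f ≫ deriv R) = lift x f ≫
      curry (app ((snd (D R) (R ⊗ Fn R) ≫ fst R (Fn R)) + (fst (D R) (R ⊗ Fn R) ≫ D.ι R))
        (snd (D R) (R ⊗ Fn R) ≫ snd R (Fn R))) ≫ principalPart R := by
  rw [deriv, app_curry]

/-- `f' (x) = c` as soon as `f (x + d) = f (x) + d * c` for all `d` in `D`. -/
theorem app_deriv_eq (x : X ⟶ R) (f : X ⟶ Fn R) (c : X ⟶ R)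
    (h : ∀ ⦃Y : C⦄ (u : Y ⟶ X) (d : Y ⟶ R), d * d = 0 →
      app (u ≫ x + d) (u ≫ f) = app (u ≫ x) (u ≫ f) + d * (u ≫ c)) :
    app x (f ≫ deriv R) = c := by
  have key : lift x f ≫
      curry (app ((snd (D R) (R ⊗ Fn R) ≫ fst R (Fn R)) + (fst (D R) (R ⊗ Fn R) ≫ D.ι R))
        (snd (D R) (R ⊗ Fn R) ≫ snd R (Fn R))) = lift (app x f) c ≫ alpha R := by
    apply ihom_ext
    intro Y u d
    rw [← Category.assoc, lift_curry_ev, ← Category.assoc, alpha_apply, comp_app]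
    have hd : (d ≫ D.ι R) * (d ≫ D.ι R) = 0 := by
      rw [← MonObj.comp_mul, D.ι_mul_self, AddMonObj.comp_zero]
    have := h u _ hd
    simpa [AddMonObj.comp_add, comp_app] using this
  rw [app_deriv, ← Category.assoc, key]
  simp [principalPart]

/-- Taylor's formula `f (x + d) = f (x) + d * f' (x)` for `d` in `D`. -/
theorem taylor (x d : X ⟶ R) (hd : d * d = 0) (f : X ⟶ Fn R) :
    app (x + d) f = app x f + d * app x (f ≫ deriv R) := by
  have gen : ∀ e : X ⟶ D R, app (x + e ≫ D.ι R) f =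
      (lift x f ≫ curry (app ((snd (D R) (R ⊗ Fn R) ≫ fst R (Fn R)) +
        (fst (D R) (R ⊗ Fn R) ≫ D.ι R)) (snd (D R) (R ⊗ Fn R) ≫ snd R (Fn R))) ≫
          inv (alpha R)) ≫ fst R R + (e ≫ D.ι R) * app x (f ≫ deriv R) := by
    intro e
    have h1 := alpha_apply e (lift x f ≫ curry (app ((snd (D R) (R ⊗ Fn R) ≫ fst R (Fn R)) +
        (fst (D R) (R ⊗ Fn R) ≫ D.ι R)) (snd (D R) (R ⊗ Fn R) ≫ snd R (Fn R))) ≫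
          inv (alpha R))
    simp only [Category.assoc, IsIso.inv_hom_id, Category.comp_id] at h1
    rw [lift_curry_ev] at h1
    simp only [comp_app, AddMonObj.comp_add] at h1
    rw [app_deriv]
    simpa [principalPart] using h1
  obtain ⟨e, rfl⟩ := D.exists_lift d hd
  obtain ⟨z, hz⟩ := D.exists_lift (0 : X ⟶ R) (by simp)
  have h0 := gen z
  rw [hz] at h0
  simp only [add_zero, zero_mul] at h0
  rw [gen e, ← h0]

theorem comp_linComb_app (r : X ⟶ R) (f g : X ⟶ Fn R) (x : X ⟶ R) :
    app x (lift r (lift f g) ≫ linComb R) = r * app x f + app x g := by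
  rw [linComb, app_curry]
  simp [MonObj.comp_mul, AddMonObj.comp_add, comp_app]

theorem comp_lift_linComb (u : Y ⟶ X) (r : X ⟶ R) (f g : X ⟶ Fn R) :
    u ≫ lift r (lift f g) ≫ linComb R =
      lift (u ≫ r) (lift (u ≫ f) (u ≫ g)) ≫ linComb R := by
  rw [← comp_lift, ← comp_lift, Category.assoc]

/-- Differentiation is linear. -/
theorem linComb_deriv (r : X ⟶ R) (f g : X ⟶ Fn R) :
    (lift r (lift f g) ≫ linComb R) ≫ deriv R =
      lift r (lift (f ≫ deriv R) (g ≫ deriv R)) ≫ linComb R := by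
  apply fn_ext
  intro Y u x
  rw [← Category.assoc, comp_lift_linComb, comp_lift_linComb, comp_linComb_app]
  apply app_deriv_eq
  intro Z w d hd
  rw [comp_lift_linComb, comp_linComb_app, comp_linComb_app, taylor _ _ hd, taylor _ _ hd]
  simp only [MonObj.comp_mul, AddMonObj.comp_add, comp_app, Category.assoc]
  ring

variable [IntegrationAxiom R]

variable (R) in
/-- The map `R ^ R ⟶ R ^ R` taking a function `f` to its primitive `F` with `F (0) = 0`. -/
def primitive : Fn R ⟶ Fn R :=
  (IntegrationAxiom.existsUnique_primitive (𝟙 (Fn R))).choose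

theorem primitive_deriv : primitive R ≫ deriv R = 𝟙 (Fn R) :=
  (IntegrationAxiom.existsUnique_primitive (𝟙 (Fn R))).choose_spec.1.1

theorem app_zero_primitive (f : X ⟶ Fn R) : app 0 (f ≫ primitive R) = 0 := by
  have h : app 0 (primitive R) = 0 :=
    (IntegrationAxiom.existsUnique_primitive (𝟙 (Fn R))).choose_spec.1.2
  have h' := congrArg (f ≫ ·) h
  simpa [comp_app, AddMonObj.comp_zero] using h'

theorem eq_primitive {f F : X ⟶ Fn R} (h : F ≫ deriv R = f) (h0 : app 0 F = 0) :
    F = f ≫ primitive R :=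
  (IntegrationAxiom.existsUnique_primitive f).unique ⟨h, h0⟩
    ⟨by rw [Category.assoc, primitive_deriv, Category.comp_id], app_zero_primitive f⟩

/-- The integral `∫ x in a..b, f (x)` of a function `f` from `a` to `b`, all given at stage `X`:
the difference `F (b) - F (a)` for the primitive `F` of `f`. -/
def integral (a b : X ⟶ R) (f : X ⟶ Fn R) : X ⟶ R :=
  app b (f ≫ primitive R) - app a (f ≫ primitive R)

theorem comp_integral (u : Y ⟶ X) (a b : X ⟶ R) (f : X ⟶ Fn R) :
    u ≫ integral a b f = integral (u ≫ a) (u ≫ b) (u ≫ f) := by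
  simp [integral, comp_app, AddGrpObj.comp_sub]

/-- The integral is linear in the function. -/
theorem integral_linComb (a b r : X ⟶ R) (f g : X ⟶ Fn R) :
    integral a b (lift r (lift f g) ≫ linComb R) = r * integral a b f + integral a b g := by
  have h : lift r (lift (f ≫ primitive R) (g ≫ primitive R)) ≫ linComb R =
      (lift r (lift f g) ≫ linComb R) ≫ primitive R := by
    apply eq_primitive
    · rw [linComb_deriv]
      simp only [Category.assoc, primitive_deriv, Category.comp_id]
    · rw [comp_linComb_app, app_zero_primitive, app_zero_primitive]
      simp
  rw [integral, integral, integral, ← h, comp_linComb_app, comp_linComb_app]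
  ring

/-- The functional `f ↦ ∫ x in a..b, f (x)`, for `a` and `b` given at stage `X`. -/
def intervalFunctional (a b : X ⟶ R) : X ⟶ Functional R :=
  curry (integral (snd (Fn R) X ≫ a) (snd (Fn R) X ≫ b) (fst (Fn R) X))

theorem intervalFunctional_app (u : Y ⟶ X) (a b : X ⟶ R) (f : Y ⟶ Fn R) :
    Functional.app (u ≫ intervalFunctional a b) f = integral (u ≫ a) (u ≫ b) f := by
  rw [intervalFunctional, functional_app_curry, comp_integral]
  simp

theorem intervalFunctional_linear (a b : X ⟶ R) :
    intervalFunctional a b ≫ atLinComb R = intervalFunctional a b ≫ linCombAt R := by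
  apply ihom_ext
  intro Y u w
  rw [← Category.assoc, ← Category.assoc, atLinComb, linCombAt, lift_curry_ev, lift_curry_ev]
  simp only [MonObj.comp_mul, AddMonObj.comp_add, comp_functional_app, lift_fst_assoc, lift_snd,
    intervalFunctional_app]
  rw [← integral_linComb]
  congr 1
  rw [← Category.assoc, ← Category.assoc]
  congr 1
  ext <;> simp

/-- The interval `[a, b]` in the distribution theoretic sense, for `a` and `b` given at stage `X`:
the distribution `f ↦ ∫ x in a..b, f (x)`. -/
def interval (a b : X ⟶ R) : X ⟶ Distribution R :=
  equalizer.lift (intervalFunctional a b) (intervalFunctional_linear a b)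

end Calculus

end Lemmas

end SDG

end

/-!
Testing two equal intervals on the constant function `1` shows that they have the same length `l`.
Testing them on the identity function shows `2 * l * (a₁ - a₂) = 0`, and `2` is invertible: if `J`
is the primitive of the identity, then `2 * J (x) = x * x` (`two_mul_app_primitive_idFn`), whence
`2 * J (1) = 1`.

Conversely, let `F` be a primitive of `f`. Integration along a line yields Hadamard's lemma
`F (a + l) - F (a) = l * q`, with `q = ∫ t in 0..1, F' (a + l * t)` (`exists_app_add_eq`). Taken at
the generic `a`, this makes `q` the value at `a` of a function `G` (`exists_fn_app_add_eq`), and a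
second application of Hadamard's lemma, to `G`, shows that
`∫ x in a₁..a₁ + l, f (x) - ∫ x in a₂..a₂ + l, f (x) = l * (G (a₁) - G (a₂))` is a multiple of
`l * (a₁ - a₂)`.
-/

open CategoryTheory Limits MonoidalCategory CartesianMonoidalCategory MonoidalClosed
open scoped CommRingObj

namespace SDG

variable {C : Type u} [Category.{v} C] [CartesianMonoidalCategory C] [BraidedCategory C]
  [MonoidalClosed C] [HasFiniteLimits C] {R : C} [CommRingObj R] {X Y : C}

/-- The function on the line, given at stage `X`, whose value at the generic `x` is `φ`; the first
factor of `R ⊗ X` is the variable of the function. -/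
noncomputable abbrev fnMk (φ : R ⊗ X ⟶ R) : X ⟶ Fn R := curry φ

theorem app_comp_fnMk (x : Y ⟶ R) (u : Y ⟶ X) (φ : R ⊗ X ⟶ R) :
    app x (u ≫ fnMk φ) = lift x u ≫ φ := app_curry x u φ

theorem app_fnMk (x : X ⟶ R) (φ : R ⊗ X ⟶ R) : app x (fnMk φ) = lift x (𝟙 X) ≫ φ := by
  rw [← app_comp_fnMk, Category.id_comp]

variable (R X) in
/-- The constant function with value `1`, at stage `X`. -/
noncomputable def oneFn : X ⟶ Fn R := fnMk 1

variable (R X) in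
/-- The identity function of the line, at stage `X`. -/
noncomputable def idFn : X ⟶ Fn R := fnMk (fst R X)

theorem app_comp_oneFn (x : Y ⟶ R) (u : Y ⟶ X) : app x (u ≫ oneFn R X) = 1 := by
  rw [oneFn, app_comp_fnMk, MonObj.comp_one]

theorem app_comp_idFn (x : Y ⟶ R) (u : Y ⟶ X) : app x (u ≫ idFn R X) = x := by
  rw [idFn, app_comp_fnMk, lift_fst]

theorem app_idFn (x : X ⟶ R) : app x (idFn R X) = x := by
  rw [idFn, app_fnMk, lift_fst]

section Calculus

variable [KockLawvere R]

/-- To compute a derivative it suffices to have Taylor's formula at all later stages. -/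
theorem deriv_eq_of_taylor {F f : X ⟶ Fn R}
    (h : ∀ ⦃Y : C⦄ (u : Y ⟶ X) (x d : Y ⟶ R), d * d = 0 →
      app (x + d) (u ≫ F) = app x (u ≫ F) + d * app x (u ≫ f)) :
    F ≫ deriv R = f := by
  apply fn_ext
  intro Y u x
  rw [← Category.assoc]
  apply app_deriv_eq
  intro Z w d hd
  simpa [comp_app] using h (w ≫ u) (w ≫ x) d hd

theorem idFn_deriv : idFn R X ≫ deriv R = oneFn R X := by
  apply deriv_eq_of_taylor
  intro Y u x d _
  rw [app_comp_idFn, app_comp_idFn, app_comp_oneFn, mul_one]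

variable [IntegrationAxiom R]

theorem eq_of_deriv_eq {F G : X ⟶ Fn R} (h : F ≫ deriv R = G ≫ deriv R)
    (hF : app 0 F = 0) (hG : app 0 G = 0) : F = G :=
  (eq_primitive h hF).trans (eq_primitive rfl hG).symm

/-- Taylor's formula for a primitive of `f`, whose derivative is `f` itself. -/
theorem taylor_primitive (x d : X ⟶ R) (hd : d * d = 0) (f : X ⟶ Fn R) :
    app (x + d) (f ≫ primitive R) = app x (f ≫ primitive R) + d * app x f := by
  rw [taylor _ _ hd, Category.assoc, primitive_deriv, Category.comp_id]

theorem integral_oneFn (a b : X ⟶ R) : integral a b (oneFn R X) = b - a := by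
  rw [integral, ← eq_primitive idFn_deriv (app_idFn 0), app_idFn, app_idFn]

theorem two_mul_app_primitive_idFn (x : X ⟶ R) :
    2 * app x (idFn R X ≫ primitive R) = x * x := by
  let J : R ⊗ X ⟶ R := app (fst R X) (snd R X ≫ idFn R X ≫ primitive R)
  have hJ : ∀ ⦃Y : C⦄ (u : Y ⟶ X) (y : Y ⟶ R),
      lift y u ≫ J = app y ((u ≫ idFn R X) ≫ primitive R) := by
    intro Y u y
    simp [J, comp_app]
  have h : fnMk (J + J) = fnMk (fst R X * fst R X) := by
    apply eq_of_deriv_eq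
    · trans fnMk (fst R X + fst R X)
      · apply deriv_eq_of_taylor
        intro Y u y d hd
        simp only [app_comp_fnMk, AddMonObj.comp_add, hJ, lift_fst]
        rw [taylor_primitive _ _ hd, app_comp_idFn]
        ring
      · symm
        apply deriv_eq_of_taylor
        intro Y u y d hd
        simp only [app_comp_fnMk, AddMonObj.comp_add, MonObj.comp_mul, lift_fst]
        linear_combination hd
    · rw [app_fnMk, AddMonObj.comp_add, hJ, app_zero_primitive, add_zero]
    · rw [app_fnMk, MonObj.comp_mul, lift_fst, mul_zero]
  have h' := congrArg (app x) h
  rw [app_fnMk, app_fnMk, AddMonObj.comp_add, MonObj.comp_mul, hJ, lift_fst,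
    Category.id_comp] at h'
  rw [two_mul, h']

theorem isUnit_two : IsUnit (2 : X ⟶ R) :=
  IsUnit.of_mul_eq_one _ ((two_mul_app_primitive_idFn 1).trans (mul_one 1))

theorem two_mul_integral_idFn (a b : X ⟶ R) : 2 * integral a b (idFn R X) = b * b - a * a := by
  rw [integral, mul_sub, two_mul_app_primitive_idFn, two_mul_app_primitive_idFn]

/-- Hadamard's lemma: the increment of `F` from `a` to `a + l` is a multiple of `l`. -/
theorem exists_app_add_eq (F : X ⟶ Fn R) (a l : X ⟶ R) :
    ∃ q : X ⟶ R, app (a + l) F = app a F + l * q := by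
  -- `S` is the function `t ↦ F' (a + l * t)`, and `P` is its primitive.
  let S : X ⟶ Fn R :=
    fnMk (app (snd R X ≫ a + (snd R X ≫ l) * fst R X) (snd R X ≫ F ≫ deriv R))
  let P : X ⟶ Fn R := S ≫ primitive R
  have h : fnMk (app (snd R X ≫ a + (snd R X ≫ l) * fst R X) (snd R X ≫ F) -
      snd R X ≫ app a F) = fnMk ((snd R X ≫ l) * app (fst R X) (snd R X ≫ P)) := by
    apply eq_of_deriv_eq
    · trans fnMk ((snd R X ≫ l) * app (fst R X) (snd R X ≫ S))
      · apply deriv_eq_of_taylor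
        intro Y u t d hd
        have hld : ((u ≫ l) * d) * ((u ≫ l) * d) = 0 := by
          linear_combination (u ≫ l) * (u ≫ l) * hd
        have ht := taylor (u ≫ a + (u ≫ l) * t) ((u ≫ l) * d) hld (u ≫ F)
        rw [add_assoc, ← mul_add] at ht
        simp only [S, app_comp_fnMk, AddGrpObj.comp_sub, MonObj.comp_mul, AddMonObj.comp_add,
          comp_app, lift_fst, lift_snd_assoc, ht, Category.assoc]
        ring
      · symm
        apply deriv_eq_of_taylor
        intro Y u t d hd
        have ht := taylor_primitive t d hd (u ≫ S)
        simp only [Category.assoc] at ht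
        simp only [P, app_comp_fnMk, MonObj.comp_mul, comp_app, lift_fst, lift_snd_assoc, ht]
        ring
    · simp only [app_fnMk, AddGrpObj.comp_sub, AddMonObj.comp_add, MonObj.comp_mul, comp_app,
        lift_fst, lift_snd_assoc, Category.id_comp, mul_zero, add_zero, sub_self]
    · simp only [app_fnMk, MonObj.comp_mul, comp_app, lift_fst, lift_snd_assoc, Category.id_comp,
        P, app_zero_primitive, mul_zero]
  refine ⟨app 1 P, ?_⟩
  have h' := congrArg (app 1) h
  simp only [app_fnMk, AddGrpObj.comp_sub, AddMonObj.comp_add, MonObj.comp_mul, comp_app,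
    lift_fst, lift_snd_assoc, Category.id_comp, mul_one] at h'
  linear_combination h'

/-- Hadamard's lemma with a quotient that is a function of `a`. -/
theorem exists_fn_app_add_eq (F : X ⟶ Fn R) (l : X ⟶ R) :
    ∃ G : X ⟶ Fn R, ∀ a : X ⟶ R, app (a + l) F = app a F + l * app a G := by
  -- At stage `R ⊗ X`, the first projection is the generic point `a`.
  obtain ⟨q, hq⟩ := exists_app_add_eq (snd R X ≫ F) (fst R X) (snd R X ≫ l)
  refine ⟨fnMk q, fun a => ?_⟩
  have h := congrArg (lift a (𝟙 X) ≫ ·) hq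
  simpa [comp_app, AddMonObj.comp_add, MonObj.comp_mul, app_fnMk] using h

theorem integral_eq_of_mul_sub_eq_zero {a₁ b₁ a₂ b₂ : X ⟶ R} (hl : b₁ - a₁ = b₂ - a₂)
    (h : (b₁ - a₁) * (a₁ - a₂) = 0) (f : X ⟶ Fn R) : integral a₁ b₁ f = integral a₂ b₂ f := by
  obtain ⟨G, hG⟩ := exists_fn_app_add_eq (f ≫ primitive R) (b₁ - a₁)
  obtain ⟨q, hq⟩ := exists_app_add_eq G a₂ (a₁ - a₂)
  have h₁ := hG a₁
  have h₂ := hG a₂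
  rw [add_sub_cancel] at h₁ hq
  rw [hl, add_sub_cancel, ← hl] at h₂
  rw [integral, integral]
  linear_combination h₁ - h₂ + (b₁ - a₁) * hq + q * h

theorem interval_comp_ι (a b : X ⟶ R) :
    interval a b ≫ Distribution.ι R = intervalFunctional a b :=
  equalizer.lift_ι _ _

theorem interval_eq_iff_intervalFunctional_eq {a₁ b₁ a₂ b₂ : X ⟶ R} :
    interval a₁ b₁ = interval a₂ b₂ ↔ intervalFunctional a₁ b₁ = intervalFunctional a₂ b₂ := by
  refine ⟨fun h => ?_, fun h => equalizer.hom_ext ?_⟩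
  · rw [← interval_comp_ι, h, interval_comp_ι]
  · exact (interval_comp_ι a₁ b₁).trans (h.trans (interval_comp_ι a₂ b₂).symm)

theorem integral_eq_of_interval_eq {a₁ b₁ a₂ b₂ : X ⟶ R}
    (h : interval a₁ b₁ = interval a₂ b₂) (f : X ⟶ Fn R) :
    integral a₁ b₁ f = integral a₂ b₂ f := by
  have h₁ := intervalFunctional_app (𝟙 X) a₁ b₁ f
  have h₂ := intervalFunctional_app (𝟙 X) a₂ b₂ f
  rw [Category.id_comp, Category.id_comp, Category.id_comp] at h₁ h₂
  rw [← h₁, ← h₂, interval_eq_iff_intervalFunctional_eq.1 h]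

theorem length_eq_of_interval_eq {a₁ b₁ a₂ b₂ : X ⟶ R}
    (h : interval a₁ b₁ = interval a₂ b₂) : b₁ - a₁ = b₂ - a₂ := by
  simpa only [integral_oneFn] using integral_eq_of_interval_eq h (oneFn R X)

theorem mul_sub_eq_zero_of_interval_eq {a₁ b₁ a₂ b₂ : X ⟶ R}
    (h : interval a₁ b₁ = interval a₂ b₂) : (b₁ - a₁) * (a₁ - a₂) = 0 := by
  have hl := length_eq_of_interval_eq h
  have hi := congrArg (2 * ·) (integral_eq_of_interval_eq h (idFn R X))
  simp only [two_mul_integral_idFn] at hi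
  refine isUnit_two.mul_left_cancel (a := (2 : X ⟶ R)) ?_
  -- `b * b - a * a = l * (2 * a + l)` for an interval of length `l = b - a`.
  linear_combination hi - (b₂ + a₂ + (b₁ - a₁)) * hl

theorem interval_eq_iff {a₁ b₁ a₂ b₂ : X ⟶ R} :
    interval a₁ b₁ = interval a₂ b₂ ↔ b₁ - a₁ = b₂ - a₂ ∧ (b₁ - a₁) * (a₁ - a₂) = 0 := by
  refine ⟨fun h => ⟨length_eq_of_interval_eq h, mul_sub_eq_zero_of_interval_eq h⟩, ?_⟩
  rintro ⟨hl, h⟩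
  rw [interval_eq_iff_intervalFunctional_eq]
  apply ihom_ext
  intro Y u f
  change Functional.app _ f = Functional.app _ f
  rw [intervalFunctional_app, intervalFunctional_app]
  apply integral_eq_of_mul_sub_eq_zero
  · rw [← AddGrpObj.comp_sub, hl, AddGrpObj.comp_sub]
  · rw [← AddGrpObj.comp_sub, ← AddGrpObj.comp_sub, ← MonObj.comp_mul, h, AddMonObj.comp_zero]

end Calculus

end SDG

theorem mainTheorem12 {C : Type u} [Category.{v} C] [CartesianMonoidalCategory C]
    [BraidedCategory C] [MonoidalClosed C] [HasFiniteLimits C] (R : C) [CommRingObj R]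
    [SDG.KockLawvere R] [SDG.IntegrationAxiom R] {X : C} :
    (∀ a₁ b₁ a₂ b₂ : X ⟶ R,
      (SDG.interval a₁ b₁ = SDG.interval a₂ b₂ ↔
        b₁ - a₁ = b₂ - a₂ ∧ (b₁ - a₁) * (a₁ - a₂) = 0) ∧
      (SDG.interval a₁ b₁ = SDG.interval a₂ b₂ → (b₁ - a₁) * (b₁ - b₂) = 0) ∧
      (IsUnit (b₁ - a₁) → SDG.interval a₁ b₁ = SDG.interval a₂ b₂ → a₁ = a₂ ∧ b₁ = b₂)) ∧
    (∀ t₁ t₂ : X ⟶ R, SDG.interval (-t₁) t₁ = SDG.interval (-t₂) t₂ → t₁ = t₂) := by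
  refine ⟨fun a₁ b₁ a₂ b₂ => ⟨SDG.interval_eq_iff, fun h => ?_, fun hu h => ?_⟩,
    fun t₁ t₂ h => ?_⟩
  · obtain ⟨hl, h0⟩ := SDG.interval_eq_iff.1 h
    linear_combination h0 + (b₁ - a₁) * hl
  · obtain ⟨hl, h0⟩ := SDG.interval_eq_iff.1 h
    have ha : a₁ = a₂ := sub_eq_zero.1 (hu.mul_right_eq_zero.1 h0)
    exact ⟨ha, by linear_combination hl + ha⟩
  · have hl := SDG.length_eq_of_interval_eq h
    refine SDG.isUnit_two.mul_left_cancel (a := (2 : X ⟶ R)) ?_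
    linear_combination hl
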